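/- Let $K$ be a compact Hausdorff space, let $C(K)$ be the algebra of real-valued continuous functions on $K$, and let $F$ be a real Banach lattice with a quasi-interior point $u$, that is, $u \ge 0$ and the order ideal $\{x \in F : |x| \le r u \text{ for some } r \in \mathbb{R}\}$ is dense in $F$. Let the ideal center of $F$, $$Z(F) = \{S : F \to F \text{ bounded linear} : \text{ there is } r > 0 \text{ with } |Sx| \le r x \text{ for all } x \ge 0\},$$ be identified with $C(K)$ as an algebra and as a Banach lattice (where $S \ge 0$ in $Z(F)$ means $Sx \ge 0$ for all $x \ge 0$, and $Z(F)$ carries the operator norm). Regard $C(K)$ as a subspace of $F$ through $a \mapsto a u$. Let $X$ be a real Banach space. For $f \in C(K,X)$ let $|f|_X \in C(K)$ be the function $|f|_X(t) = \|f(t)\|$, and let $F_\pi(X)$ be the completion of $C(K,X)$ in the norm $\|f\|_{F(X)} = \|\,|f|_X\,\|_F$; it is a Banach $C(K)$-module, the product $af$ ($a \in C(K)$) being the continuous extension of the pointwise product on $C(K,X)$. For $x \in X$ let $\vec{x} \in C(K,X) \subset F_\pi(X)$ be the constant function with value $x$, and let $F(\vec{x})$ be the closure of $\{a\vec{x} :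 a \in C(K)\}$ in $F_\pi(X)$. Let $T$ be a bounded linear operator on $F_\pi(X)$. Then the following are equivalent: (i) $T$ is a multiplication operator: there is $a \in C(K)$ such that $T f = a f$ for all $f \in F_\pi(X)$. (ii) Both of the following hold: (a) $T(F(\vec{x})) \subset F(\vec{x})$ for each $x \in X$; (b) $T(a f) = a\, T f$ for all $x \in X$, $f \in F(\vec{x})$ and $a \in C(K)$. -/

import Mathlib

section MultiplicationOperators

/-- An element `u` of a normed lattice is a quasi-interior point (of the positive cone) if
`0 ≤ u` and the order ideal `{x | |x| ≤ r u for some real r}` generated by `u` is dense. -/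
def IsQuasiInteriorPoint {F : Type*} [NormedAddCommGroup F] [NormedSpace ℝ F] [Lattice F]
    (u : F) : Prop :=
  0 ≤ u ∧ Dense {x : F | ∃ r : ℝ, |x| ≤ r • u}

theorem abs_apply_le_of_center {F : Type*} [NormedAddCommGroup F] [NormedSpace ℝ F] [Lattice F]
    [IsOrderedAddMonoid F] {T : F →L[ℝ] F} {r : ℝ}
    (h : ∀ x : F, 0 ≤ x → |T x| ≤ r • x) (x : F) : |T x| ≤ r • |x| := by
  have h1 := h _ (posPart_nonneg x)
  have h2 := h _ (negPart_nonneg x)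
  calc |T x| = |T (x⁺) - T (x⁻)| := by rw [← map_sub, posPart_sub_negPart]
    _ ≤ |T (x⁺)| + |T (x⁻)| := by
      rw [sub_eq_add_neg]
      exact (abs_add_le _ _).trans (by rw [abs_neg])
    _ ≤ r • x⁺ + r • x⁻ := add_le_add h1 h2
    _ = r • |x| := by rw [← smul_add, posPart_add_negPart]

/-- The ideal center `Z(F)` of a normed lattice `F`: the bounded operators `T` such that, for some
`r > 0`, `|T x| ≤ r x` for all `x ≥ 0`. -/
def idealCenter (F : Type*) [NormedAddCommGroup F] [NormedSpace ℝ F] [Lattice F]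
    [IsOrderedAddMonoid F] [IsOrderedModule ℝ F] : Subalgebra ℝ (F →L[ℝ] F) where
  carrier := {T | ∃ r : ℝ, 0 < r ∧ ∀ x : F, 0 ≤ x → |T x| ≤ r • x}
  mul_mem' := by
    rintro S T ⟨r, hr, hS⟩ ⟨s, hs, hT⟩
    refine ⟨r * s, mul_pos hr hs, fun x hx => ?_⟩
    calc |S (T x)| ≤ r • |T x| := abs_apply_le_of_center hS _
      _ ≤ r • s • x := smul_le_smul_of_nonneg_left (hT x hx) hr.le
      _ = (r * s) • x := smul_smul _ _ _
  add_mem' := by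
    rintro S T ⟨r, hr, hS⟩ ⟨s, hs, hT⟩
    refine ⟨r + s, add_pos hr hs, fun x hx => ?_⟩
    calc |S x + T x| ≤ |S x| + |T x| := abs_add_le _ _
      _ ≤ r • x + s • x := add_le_add (hS x hx) (hT x hx)
      _ = (r + s) • x := (add_smul _ _ _).symm
  algebraMap_mem' := by
    intro c
    refine ⟨|c| + 1, by positivity, fun x hx => ?_⟩
    have e : (algebraMap ℝ (F →L[ℝ] F) c) x = c • x := by
      simp [Algebra.algebraMap_eq_smul_one]
    rw [e]
    refine abs_le'.mpr ⟨?_, ?_⟩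
    · exact smul_le_smul_of_nonneg_right ((le_abs_self c).trans (by linarith)) hx
    · rw [← neg_smul]
      exact smul_le_smul_of_nonneg_right ((neg_le_abs c).trans (by linarith)) hx

/-- An identification `Z(F) = C(K)`, as algebras and as Banach lattices: an algebra isomorphism
that preserves the order in both directions (`Z(F)` being ordered by `0 ≤ T` iff `0 ≤ T x` for all
`x ≥ 0`) and the norm. -/
structure CenterIdentification (K F : Type*) [TopologicalSpace K] [CompactSpace K]
    [NormedAddCommGroup F] [NormedSpace ℝ F] [Lattice F] [IsOrderedAddMonoid F]
    [IsOrderedModule ℝ F] where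
  toAlgEquiv : C(K, ℝ) ≃ₐ[ℝ] idealCenter F
  nonneg_iff : ∀ a : C(K, ℝ),
    0 ≤ a ↔ ∀ x : F, 0 ≤ x → 0 ≤ (toAlgEquiv a : F →L[ℝ] F) x
  norm_map : ∀ a : C(K, ℝ), ‖(toAlgEquiv a : F →L[ℝ] F)‖ = ‖a‖

/-- The norm function `|f|_X ∈ C(K)` of `f ∈ C(K, X)`: `|f|_X(t) = ‖f t‖`. -/
def normFunction {K X : Type*} [TopologicalSpace K] [NormedAddCommGroup X]
    (f : C(K, X)) : C(K, ℝ) :=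
  ⟨fun t => ‖f t‖, f.continuous.norm⟩

section Space

variable {K F : Type*} [TopologicalSpace K] [CompactSpace K]
  [NormedAddCommGroup F] [NormedSpace ℝ F] [Lattice F]
  [IsOrderedAddMonoid F] [IsOrderedModule ℝ F]

/-- The embedding `C(K) → F`, `a ↦ a u`, through which `C(K)` is regarded as a subspace of `F`
(with the constant function `1` corresponding to `u`). -/
def CenterIdentification.embed (φ : CenterIdentification K F) (u : F) : C(K, ℝ) →ₗ[ℝ] F where
  toFun a := (φ.toAlgEquiv a : F →L[ℝ] F) u
  map_add' a b := by simp
  map_smul' c a := by simp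

theorem CenterIdentification.embed_mono (φ : CenterIdentification K F) {u : F} (hu : 0 ≤ u)
    {a b : C(K, ℝ)} (h : a ≤ b) : φ.embed u a ≤ φ.embed u b := by
  have h1 : 0 ≤ φ.embed u (b - a) := (φ.nonneg_iff (b - a)).1 (sub_nonneg.2 h) u hu
  rw [map_sub] at h1
  exact sub_nonneg.1 h1

theorem CenterIdentification.norm_embed_le [HasSolidNorm F] (φ : CenterIdentification K F) {u : F}
    (hu : 0 ≤ u) {a b : C(K, ℝ)} (ha : 0 ≤ a) (h : a ≤ b) :
    ‖φ.embed u a‖ ≤ ‖φ.embed u b‖ := by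
  have h0 : 0 ≤ φ.embed u a := (φ.nonneg_iff a).1 ha u hu
  have h1 := φ.embed_mono hu h
  apply norm_le_norm_of_abs_le_abs
  rwa [abs_of_nonneg h0, abs_of_nonneg (h0.trans h1)]

/-- The vector space `C(K, X)`, to be normed by `‖f‖ = ‖ |f|_X ‖_F`. -/
def PreFpi (_φ : CenterIdentification K F) {u : F} (_hu : IsQuasiInteriorPoint u)
    (X : Type*) [NormedAddCommGroup X] [NormedSpace ℝ X] : Type _ :=
  C(K, X)

variable (φ : CenterIdentification K F) {u : F} (hu : IsQuasiInteriorPoint u)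
  (X : Type*) [NormedAddCommGroup X] [NormedSpace ℝ X]

instance : AddCommGroup (PreFpi φ hu X) := inferInstanceAs (AddCommGroup C(K, X))

instance : Module ℝ (PreFpi φ hu X) := inferInstanceAs (Module ℝ C(K, X))

/-- The pointwise product `a f` of `a ∈ C(K)` and `f ∈ C(K, X)`. -/
instance : Module C(K, ℝ) (PreFpi φ hu X) := inferInstanceAs (Module C(K, ℝ) C(K, X))

/-- A continuous function `K → X` as an element of the renormed space. -/
def PreFpi.of (f : C(K, X)) : PreFpi φ hu X := f

variable {X} in
/-- The underlying continuous function `K → X`. -/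
def PreFpi.toFun (f : PreFpi φ hu X) : C(K, X) := f

/-- The norm `‖f‖ = ‖ |f|_X ‖_F`, where `|f|_X ∈ C(K)` is regarded as an element of `F`. -/
instance : Norm (PreFpi φ hu X) := ⟨fun f => ‖φ.embed u (normFunction (f.toFun φ hu))‖⟩

theorem PreFpi.norm_def (f : PreFpi φ hu X) :
    ‖f‖ = ‖φ.embed u (normFunction (f.toFun φ hu))‖ := rfl

variable [HasSolidNorm F]

theorem PreFpi.core : SeminormedSpace.Core ℝ (PreFpi φ hu X) where
  norm_nonneg f := norm_nonneg (φ.embed u (normFunction (f.toFun φ hu)))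
  norm_smul c f := by
    have e : normFunction ((c • f).toFun φ hu) = ‖c‖ • normFunction (f.toFun φ hu) := by
      ext t
      exact norm_smul c (f.toFun φ hu t)
    rw [PreFpi.norm_def, PreFpi.norm_def, e, map_smul, norm_smul, norm_norm]
  norm_triangle f g := by
    rw [PreFpi.norm_def, PreFpi.norm_def, PreFpi.norm_def]
    refine le_trans (φ.norm_embed_le hu.1 (b := normFunction (f.toFun φ hu) +
      normFunction (g.toFun φ hu)) (fun t => norm_nonneg _) (fun t => ?_)) ?_
    · exact norm_add_le (f.toFun φ hu t) (g.toFun φ hu t)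
    · rw [map_add]
      exact norm_add_le _ _

noncomputable instance : SeminormedAddCommGroup (PreFpi φ hu X) :=
  SeminormedAddCommGroup.ofCore (PreFpi.core φ hu X)

noncomputable instance : NormedSpace ℝ (PreFpi φ hu X) where
  norm_smul_le c f := ((PreFpi.core φ hu X).norm_smul c f).le

theorem PreFpi.norm_smul_le_mul (a : C(K, ℝ)) (f : PreFpi φ hu X) : ‖a • f‖ ≤ ‖a‖ * ‖f‖ := by
  rw [PreFpi.norm_def, PreFpi.norm_def]
  calc ‖φ.embed u (normFunction ((a • f).toFun φ hu))‖
      ≤ ‖φ.embed u (‖a‖ • normFunction (f.toFun φ hu))‖ := by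
        refine φ.norm_embed_le hu.1 (fun t => norm_nonneg _) (fun t => ?_)
        change ‖a t • f.toFun φ hu t‖ ≤ ‖a‖ * ‖f.toFun φ hu t‖
        rw [norm_smul]
        exact mul_le_mul_of_nonneg_right (a.norm_coe_le_norm t) (norm_nonneg _)
    _ = ‖a‖ * ‖φ.embed u (normFunction (f.toFun φ hu))‖ := by
        rw [map_smul, norm_smul, norm_norm]

instance : UniformContinuousConstSMul C(K, ℝ) (PreFpi φ hu X) where
  uniformContinuous_const_smul a := by
    have h : LipschitzWith ‖a‖₊ fun f : PreFpi φ hu X => a • f := by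
      refine LipschitzWith.of_dist_le_mul fun f g => ?_
      rw [dist_eq_norm, dist_eq_norm, ← smul_sub]
      exact PreFpi.norm_smul_le_mul φ hu X a (f - g)
    exact h.uniformContinuous

/-- `F_π(X)`, the completion of `C(K, X)` in the norm `‖ |f|_X ‖_F`. It is a Banach space, and a
`C(K)`-module by the continuous extension of the pointwise product. -/
abbrev Fpi : Type _ := UniformSpace.Completion (PreFpi φ hu X)

variable {X} in
/-- The constant function with value `x`, as an element of `F_π(X)`. -/
noncomputable def Fpi.const (x : X) : Fpi φ hu X :=
  ((PreFpi.of φ hu X (ContinuousMap.const K x) : PreFpi φ hu X) : Fpi φ hu X)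

end Space

/-- The cyclic subspace `M(m) = cl {a m : a ∈ C(K)}` of a `C(K)`-module `M`. -/
def cyclicSubspace (K : Type*) {M : Type*} [TopologicalSpace K] [TopologicalSpace M]
    [AddCommGroup M] [Module C(K, ℝ) M] (m : M) : Set M :=
  closure (Set.range fun a : C(K, ℝ) => a • m)

/-- `T` is a multiplication operator on the `C(K)`-module `M`: for some `a ∈ C(K)`, `T m = a m`
for all `m ∈ M`. -/
def IsMultiplicationOperator (K : Type*) {M : Type*} [TopologicalSpace K] [TopologicalSpace M]
    [AddCommGroup M] [Module ℝ M] [Module C(K, ℝ) M] (T : M →L[ℝ] M) : Prop :=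
  ∃ a : C(K, ℝ), ∀ m : M, T m = a • m

end MultiplicationOperators

/-!
The substantial direction is that the two conditions on the cyclic subspaces force `T` to be a
multiplication operator. Fix `x ≠ 0`. Since `‖a x‖ = ‖x‖ ‖a u‖` for `a ∈ C(K)`, the map
`a u ↦ a x` extends to a multiple of an isometry of `C(K)`-modules from `F` onto the
cyclic subspace of the constant function `x` (`Fpi.orbit`). If `T` maps this subspace to
itself and commutes with `C(K)` on it, then `T x` corresponds to some `g ∈ F` with
`‖b g‖ ≤ ‖T‖ ‖b u‖` for all `b ∈ C(K)`. Testing on `b` that live where `|g|` exceeds `(‖T‖ + 1) u`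
gives `|g| ≤ (‖T‖ + 1) u` (`CenterIdentification.abs_le_of_norm_op_le`). As `C(K)` is the whole
center, `C(K) u` is the whole ideal generated by `u` (`CenterIdentification.exists_embed_eq`), so
`g = b u` and `T x = b x` for some `b ∈ C(K)`. At each point `t` of `K`, the linear map
`x ↦ (T x)(t)` thus has every vector as an eigenvector, so `b` does not depend on `x`
(`Fpi.exists_forall_apply_const_eq_smul`). Hence `T` is multiplication by `b` on the sums of
products `a x`, which are dense by a partition of unity.

The fact that `C(K) u` is an ideal usually comes from Kakutani's representation of the ideal
generated by `u` as a `C(L)`. Here the multiplication of that `C(L)` is constructed inside the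
lattice. The square of `z` is the supremum of its tangents `2 s z - s² u`, `s ∈ ℝ`; it exists by
norm completeness, and it satisfies the parallelogram law because of a substitution in the
suprema (`IsUnitSquare.parallelogram`). Polarization then gives a positive bilinear product with
unit `u`, and for `0 ≤ x ≤ u` the multiplication by `x` is bounded by the identity, so it extends to
an operator in the center with value `x` at `u` (`exists_mem_idealCenter_apply_eq`).
-/

set_option linter.unusedSectionVars false

/-! ### The square of an element relative to an order unit -/

section Square

variable {F : Type*} [NormedAddCommGroup F] [NormedSpace ℝ F] [Lattice F]
  [IsOrderedAddMonoid F] [IsOrderedModule ℝ F]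

theorem abs_real_smul_le (c : ℝ) (x : F) : |c • x| ≤ |c| • |x| := by
  have h1 : ∀ y : F, |y| ≤ |x| → c • y ≤ |c| • |x| := fun y hy => by
    rcases le_total 0 c with hc | hc
    · rw [abs_of_nonneg hc]
      exact smul_le_smul_of_nonneg_left ((le_abs_self y).trans hy) hc
    · rw [abs_of_nonpos hc, ← neg_smul_neg]
      exact smul_le_smul_of_nonneg_left ((neg_le_abs y).trans hy) (neg_nonneg.2 hc)
  refine abs_le'.2 ⟨h1 x le_rfl, ?_⟩
  rw [← smul_neg]
  exact h1 (-x) (abs_neg x).le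

/-- `w` is the square of `z` relative to the unit `u`, that is, the supremum of the tangents
`2 s z - s² u` over all real `s`. In `C(K)` with `u = 1` this is the pointwise square. -/
def IsUnitSquare (u z w : F) : Prop :=
  IsLUB (Set.range fun s : ℝ => (2 * s) • z - (s ^ 2) • u) w

namespace IsUnitSquare

variable {u x y a b c d : F}

theorem tangent_le (h : IsUnitSquare u x a) (s : ℝ) : (2 * s) • x - (s ^ 2) • u ≤ a :=
  h.1 ⟨s, rfl⟩

theorem le_of_forall (h : IsUnitSquare u x a) (hb : ∀ s : ℝ, (2 * s) • x - (s ^ 2) • u ≤ b) :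
    a ≤ b :=
  h.2 (by rintro _ ⟨s, rfl⟩; exact hb s)

theorem add_le_of_forall (ha : IsUnitSquare u x a) (hb : IsUnitSquare u y b)
    (h : ∀ s t : ℝ, ((2 * s) • x - (s ^ 2) • u) + ((2 * t) • y - (t ^ 2) • u) ≤ c) :
    a + b ≤ c := by
  rw [← le_sub_iff_add_le]
  refine ha.le_of_forall fun s => ?_
  rw [le_sub_comm]
  refine hb.le_of_forall fun t => ?_
  rw [le_sub_iff_add_le']
  exact h s t

/-- The parallelogram law. It is the substitution `(s, t) ↦ (s + t, s - t)` in the suprema, so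
it needs no representation of the lattice by functions. -/
theorem parallelogram (ha : IsUnitSquare u x a) (hb : IsUnitSquare u y b)
    (hc : IsUnitSquare u (x + y) c) (hd : IsUnitSquare u (x - y) d) :
    c + d = (2 : ℝ) • a + (2 : ℝ) • b := by
  apply le_antisymm
  · refine hc.add_le_of_forall hd fun s t => ?_
    have h1 := smul_le_smul_of_nonneg_left (ha.tangent_le ((s + t) / 2)) (zero_le_two (α := ℝ))
    have h2 := smul_le_smul_of_nonneg_left (hb.tangent_le ((s - t) / 2)) (zero_le_two (α := ℝ))
    refine le_of_eq_of_le ?_ (add_le_add h1 h2)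
    module
  · have h : a + b ≤ (1 / 2 : ℝ) • (c + d) := by
      refine ha.add_le_of_forall hb fun s t => ?_
      have h1 := add_le_add (hc.tangent_le (s + t)) (hd.tangent_le (s - t))
      refine le_of_eq_of_le ?_
        (smul_le_smul_of_nonneg_left h1 (show (0 : ℝ) ≤ 1 / 2 by norm_num))
      module
    have h3 := smul_le_smul_of_nonneg_left h (zero_le_two (α := ℝ))
    refine le_of_eq_of_le ?_ (h3.trans_eq ?_) <;> module

theorem mono (ha : IsUnitSquare u x a) (hb : IsUnitSquare u y b) (h : |x| ≤ y) : a ≤ b := by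
  refine ha.le_of_forall fun s => (le_trans ?_ (hb.tangent_le |s|))
  rw [sq_abs]
  refine sub_le_sub_right ?_ _
  have h2 : |(2 * s)| = 2 * |s| := by rw [abs_mul, abs_two]
  calc (2 * s) • x ≤ |(2 * s) • x| := le_abs_self _
    _ ≤ (2 * |s|) • |x| := (abs_real_smul_le _ _).trans_eq (by rw [h2])
    _ ≤ (2 * |s|) • y := smul_le_smul_of_nonneg_left h (by positivity)

theorem unit_add (ha : IsUnitSquare u x a) (hb : IsUnitSquare u (u + x) b) :
    b = u + (2 : ℝ) • x + a := by
  apply le_antisymm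
  · refine hb.le_of_forall fun s => ?_
    refine le_of_eq_of_le ?_ (add_le_add_right (ha.tangent_le (s - 1)) (u + (2 : ℝ) • x))
    module
  · rw [← le_sub_iff_add_le']
    refine ha.le_of_forall fun s => ?_
    rw [le_sub_iff_add_le']
    refine le_of_eq_of_le ?_ (hb.tangent_le (s + 1))
    module

end IsUnitSquare

/-- A set has a supremum if it can be approximated from above by elements `b n` below all its
upper bounds, with an error relative to a fixed `e` that tends to zero. -/
theorem exists_isLUB_of_approx [CompleteSpace F] [HasSolidNorm F] {A : Set F} {e : F}
    {ε : ℕ → ℝ} (hε : Filter.Tendsto ε Filter.atTop (nhds 0)) (b : ℕ → F)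
    (hb : ∀ n, ∀ c ∈ upperBounds A, b n ≤ c)
    (hA : ∀ n, ∀ a ∈ A, a ≤ b n + ε n • e) : ∃ w, IsLUB A w := by
  have hle : ∀ m n, b m - b n ≤ ε n • e := fun m n => by
    rw [sub_le_iff_le_add']
    exact hb m _ (fun a ha => hA n a ha)
  have hcauchy : CauchySeq b := by
    refine Metric.cauchySeq_iff'.2 fun δ hδ => ?_
    have h1 : Filter.Tendsto (fun n => |ε n| * ‖e‖) Filter.atTop (nhds 0) := by
      simpa using (hε.abs.mul_const ‖e‖)
    obtain ⟨N, hN⟩ := (h1.eventually (gt_mem_nhds (half_pos hδ))).exists_forall_of_atTop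
    refine ⟨N, fun n hn => ?_⟩
    have h2 : |b n - b N| ≤ |ε n| • |e| + |ε N| • |e| := by
      have hs : ∀ k, ε k • e ≤ |ε k| • |e| := fun k => (le_abs_self _).trans (abs_real_smul_le _ _)
      have h0 : ∀ k, 0 ≤ |ε k| • |e| := fun k => smul_nonneg (abs_nonneg _) (abs_nonneg _)
      refine abs_le'.2 ⟨?_, ?_⟩
      · exact ((hle n N).trans (hs N)).trans (le_add_of_nonneg_left (h0 n))
      · rw [neg_sub]
        exact ((hle N n).trans (hs n)).trans (le_add_of_nonneg_right (h0 N))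
    have h3 : ‖b n - b N‖ ≤ ‖|ε n| • |e| + |ε N| • |e|‖ :=
      norm_le_norm_of_abs_le_abs (h2.trans (le_abs_self _))
    rw [dist_eq_norm]
    refine (h3.trans (norm_add_le _ _)).trans_lt ?_
    simp only [norm_smul, norm_abs_eq_norm, Real.norm_eq_abs]
    linarith [hN n hn, hN N le_rfl]
  obtain ⟨w, hw⟩ := cauchySeq_tendsto_of_complete hcauchy
  refine ⟨w, fun a ha => ?_, fun c hc => le_of_tendsto' hw fun n => hb n c hc⟩
  have h1 : Filter.Tendsto (fun n => b n + ε n • e) Filter.atTop (nhds (w + (0 : ℝ) • e)) :=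
    hw.add (hε.smul_const e)
  rw [zero_smul, add_zero] at h1
  exact ge_of_tendsto' h1 fun n => hA n a ha

/-- Squares exist: for `|z| ≤ r u`, the tangents with `|s| ≤ r` suffice, and these are
uniformly approximated by those at the points of a fine grid. -/
theorem exists_isUnitSquare [CompleteSpace F] [HasSolidNorm F] {u z : F} {r : ℝ} (hr : 0 < r)
    (hz : |z| ≤ r • u) : ∃ w, IsUnitSquare u z w := by
  have hzr : z ≤ r • u := (le_abs_self z).trans hz
  have hzr' : -z ≤ r • u := (neg_le_abs z).trans hz
  have hu : 0 ≤ u := by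
    have h := smul_nonneg (inv_nonneg.2 hr.le) ((abs_nonneg z).trans hz)
    rwa [smul_smul, inv_mul_cancel₀ hr.ne', one_smul] at h
  set g : ℝ → F := fun s => (2 * s) • z - (s ^ 2) • u with hg
  -- the difference of two tangents
  have hdiff : ∀ s t, g s - g t = (s - t) • ((2 : ℝ) • z - (s + t) • u) := fun s t => by
    simp only [hg]; module
  have hclose : ∀ s t, |s| ≤ r → |t| ≤ r → g s ≤ g t + (|s - t| * (4 * r)) • u := by
    intro s t hs ht
    rw [← sub_le_iff_le_add', hdiff, mul_smul]
    have h1 : |(2 : ℝ) • z - (s + t) • u| ≤ (4 * r) • u := by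
      have hst : |s + t| ≤ 2 * r := (abs_add_le s t).trans (by linarith)
      have h5 := smul_le_smul_of_nonneg_right (neg_le_of_abs_le hst) hu
      have h6 := smul_le_smul_of_nonneg_right (le_of_abs_le hst) hu
      refine abs_le'.2 ⟨?_, ?_⟩
      · refine (sub_le_sub (smul_le_smul_of_nonneg_left hzr zero_le_two) h5).trans_eq ?_
        module
      · refine le_of_eq_of_le ?_
          ((add_le_add (smul_le_smul_of_nonneg_left hzr' (zero_le_two (α := ℝ))) h6).trans_eq ?_)
        <;> module
    calc (s - t) • ((2 : ℝ) • z - (s + t) • u)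
        ≤ |(s - t) • ((2 : ℝ) • z - (s + t) • u)| := le_abs_self _
      _ ≤ |s - t| • |(2 : ℝ) • z - (s + t) • u| := abs_real_smul_le _ _
      _ ≤ |s - t| • (4 * r) • u := smul_le_smul_of_nonneg_left h1 (abs_nonneg _)
  -- tangents with `|s| ≥ r` lie below those at `±r`
  have hclamp : ∀ s, ∃ t, |t| ≤ r ∧ g s ≤ g t := by
    intro s
    rcases le_or_gt |s| r with h | h
    · exact ⟨s, h, le_rfl⟩
    rcases lt_abs.1 h with h' | h'
    · refine ⟨r, (abs_of_pos hr).le, ?_⟩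
      rw [← sub_nonpos, hdiff]
      refine smul_nonpos_of_nonneg_of_nonpos (by linarith) ?_
      rw [sub_nonpos]
      refine (smul_le_smul_of_nonneg_left hzr zero_le_two).trans ?_
      rw [smul_smul]
      exact smul_le_smul_of_nonneg_right (by linarith) hu
    · refine ⟨-r, by rw [abs_neg, abs_of_pos hr], ?_⟩
      rw [← sub_nonpos, hdiff]
      refine smul_nonpos_of_nonpos_of_nonneg (by linarith) ?_
      have h7 : (2 : ℝ) • -z ≤ (-(s + -r)) • u := by
        refine (smul_le_smul_of_nonneg_left hzr' zero_le_two).trans ?_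
        rw [smul_smul]
        exact smul_le_smul_of_nonneg_right (by linarith) hu
      rw [sub_nonneg]
      rwa [smul_neg, neg_smul, neg_le_neg_iff] at h7
  -- the grid of mesh `r / (n + 1)` on `[-r, r]`, and the maximum of the tangents at its points
  let I : ℕ → Finset ℤ := fun n => Finset.Icc (-(n + 1 : ℤ)) (n + 1)
  have hI : ∀ n, (I n).Nonempty := fun n => ⟨0, by simp [I]; omega⟩
  let p : ℕ → ℤ → ℝ := fun n k => k * (r / (n + 1))
  refine exists_isLUB_of_approx (e := (4 * r * r) • u)
    tendsto_one_div_add_atTop_nhds_zero_nat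
    (fun n => (I n).sup' (hI n) fun k => g (p n k)) ?_ ?_
  · intro n c hc
    exact Finset.sup'_le _ _ fun k _ => hc ⟨p n k, rfl⟩
  · rintro n _ ⟨s, rfl⟩
    obtain ⟨t, ht, hst⟩ := hclamp s
    have hn : (0 : ℝ) < n + 1 := by positivity
    have hm : 0 < r / (n + 1) := by positivity
    let k : ℤ := ⌊t / (r / (n + 1))⌋
    have hk1 : (k : ℝ) * (r / (n + 1)) ≤ t := by
      rw [← le_div_iff₀ hm]; exact Int.floor_le _
    have hk2 : t < ((k : ℝ) + 1) * (r / (n + 1)) := by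
      rw [← div_lt_iff₀ hm]; exact Int.lt_floor_add_one _
    have hdiv : (n + 1 : ℝ) * (r / (n + 1)) = r := by field_simp
    have hkI : k ∈ I n := by
      rw [Finset.mem_Icc]
      constructor
      · refine Int.le_floor.2 ?_
        rw [le_div_iff₀ hm]; push_cast
        linarith [neg_le_of_abs_le ht]
      · have : (k : ℝ) ≤ (n + 1 : ℝ) :=
          le_of_mul_le_mul_right (by linarith [le_of_abs_le ht]) hm
        exact_mod_cast this
    have hpk : |p n k| ≤ r := by
      obtain ⟨h8, h9⟩ := Finset.mem_Icc.1 hkI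
      have h8' : -((n : ℝ) + 1) ≤ k := by exact_mod_cast h8
      have h9' : (k : ℝ) ≤ n + 1 := by exact_mod_cast h9
      have := mul_le_mul_of_nonneg_right h8' hm.le
      have := mul_le_mul_of_nonneg_right h9' hm.le
      exact abs_le.2 ⟨by simp only [p]; linarith, by simp only [p]; linarith⟩
    have htp : |t - p n k| ≤ r / (n + 1) := by
      rw [abs_of_nonneg (by simp only [p]; linarith)]
      simp only [p]; linarith
    refine hst.trans ((hclose t (p n k) ht hpk).trans (add_le_add ?_ ?_))
    · exact Finset.le_sup' (fun k => g (p n k)) hkI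
    · rw [smul_smul]
      refine smul_le_smul_of_nonneg_right ?_ hu
      calc |t - p n k| * (4 * r) ≤ r / (n + 1) * (4 * r) := by gcongr
        _ = 1 / (n + 1) * (4 * r * r) := by ring

end Square

/-! ### Multiplication operators on the principal ideal -/

section PrincipalIdeal

variable {F : Type*} [NormedAddCommGroup F] [NormedSpace ℝ F] [Lattice F]
  [IsOrderedAddMonoid F] [IsOrderedModule ℝ F]

/-- The order ideal `{x | |x| ≤ r u for some real r}` generated by `u`, for `0 ≤ u`. -/
def principalIdeal {u : F} (_hu : 0 ≤ u) : Submodule ℝ F where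
  carrier := {x | ∃ r : ℝ, |x| ≤ r • u}
  zero_mem' := ⟨0, by simp⟩
  add_mem' := by
    rintro x y ⟨r, hr⟩ ⟨s, hs⟩
    exact ⟨r + s, (abs_add_le x y).trans ((add_le_add hr hs).trans_eq (add_smul r s u).symm)⟩
  smul_mem' := by
    rintro c x ⟨r, hr⟩
    refine ⟨|c| * r, (abs_real_smul_le c x).trans ?_⟩
    rw [mul_smul]
    exact smul_le_smul_of_nonneg_left hr (abs_nonneg c)

variable {u : F} (hu : 0 ≤ u)

theorem mem_principalIdeal_of_abs_le {x y : F} (hy : y ∈ principalIdeal hu) (h : |x| ≤ |y|) :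
    x ∈ principalIdeal hu := by
  obtain ⟨r, hr⟩ := hy
  exact ⟨r, h.trans hr⟩

theorem exists_pos_abs_le {x : F} (hx : x ∈ principalIdeal hu) :
    ∃ r : ℝ, 0 < r ∧ |x| ≤ r • u := by
  obtain ⟨r, hr⟩ := hx
  exact ⟨|r| + 1, by positivity,
    hr.trans (smul_le_smul_of_nonneg_right (by linarith [le_abs_self r]) hu)⟩

theorem unit_mem_principalIdeal : u ∈ principalIdeal hu :=
  ⟨1, by rw [one_smul, abs_of_nonneg hu]⟩

variable [CompleteSpace F] [HasSolidNorm F]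

/-- The square of an element of the principal ideal, relative to its generator. -/
noncomputable def unitSquare (x : principalIdeal hu) : F :=
  (exists_isUnitSquare (exists_pos_abs_le hu x.2).choose_spec.1
    (exists_pos_abs_le hu x.2).choose_spec.2).choose

theorem isUnitSquare_unitSquare (x : principalIdeal hu) :
    IsUnitSquare u (x : F) (unitSquare hu x) :=
  (exists_isUnitSquare (exists_pos_abs_le hu x.2).choose_spec.1
    (exists_pos_abs_le hu x.2).choose_spec.2).choose_spec

theorem unitSquare_parallelogram (x y : principalIdeal hu) :
    unitSquare hu (x + y) + unitSquare hu (x - y) =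
      (2 : ℝ) • unitSquare hu x + (2 : ℝ) • unitSquare hu y :=
  (isUnitSquare_unitSquare hu x).parallelogram (isUnitSquare_unitSquare hu y)
    (isUnitSquare_unitSquare hu (x + y)) (isUnitSquare_unitSquare hu (x - y))

theorem unitSquare_mono {x y : principalIdeal hu} (h : |(x : F)| ≤ y) :
    unitSquare hu x ≤ unitSquare hu y :=
  (isUnitSquare_unitSquare hu x).mono (isUnitSquare_unitSquare hu y) h

/-- The product of two elements of the principal ideal for which the generator is the unit,
obtained from the square by polarization. -/
noncomputable def unitMul (x y : principalIdeal hu) : F :=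
  (1 / 2 : ℝ) • (unitSquare hu (x + y) - unitSquare hu x - unitSquare hu y)

theorem unitMul_comm (x y : principalIdeal hu) : unitMul hu x y = unitMul hu y x := by
  rw [unitMul, unitMul, add_comm x y, sub_right_comm]

/-- The polar form of a map that satisfies the parallelogram law is additive
(Jordan and von Neumann). -/
theorem unitMul_add (x y z : principalIdeal hu) :
    unitMul hu x (y + z) = unitMul hu x y + unitMul hu x z := by
  have h1 := unitSquare_parallelogram hu (x + y) z
  have h2 := unitSquare_parallelogram hu (x - z) y
  have h3 := unitSquare_parallelogram hu (y + z) x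
  have h4 := unitSquare_parallelogram hu x z
  have h5 := unitSquare_parallelogram hu 0 (x - z - y)
  have h6 := unitSquare_parallelogram hu 0 0
  rw [zero_add, zero_sub] at h5
  rw [zero_add, sub_zero] at h6
  rw [show x - z + y = x + y - z by abel] at h2
  rw [show y + z - x = -(x - z - y) by abel, show y + z + x = x + y + z by abel] at h3
  simp only [unitMul]
  rw [← add_assoc]
  linear_combination (norm := module) (1 / 4 : ℝ) • h1 - (1 / 4 : ℝ) • h2 + (1 / 4 : ℝ) • h3
    - (1 / 2 : ℝ) • h4 - (1 / 4 : ℝ) • h5 + (1 / 4 : ℝ) • h6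

theorem unitMul_nonneg {x y : principalIdeal hu} (hx : 0 ≤ (x : F)) (hy : 0 ≤ (y : F)) :
    0 ≤ unitMul hu x y := by
  have h1 : |((x - y : principalIdeal hu) : F)| ≤ ((x + y : principalIdeal hu) : F) := by
    push_cast
    refine abs_le'.2 ⟨?_, ?_⟩
    · exact (sub_le_self _ hy).trans (le_add_of_nonneg_right hy)
    · rw [neg_sub]
      exact (sub_le_self _ hx).trans (le_add_of_nonneg_left hx)
  have h2 := sub_nonneg.2 (unitSquare_mono hu h1)
  have h3 := unitSquare_parallelogram hu x y
  have h4 : unitMul hu x y = (1 / 4 : ℝ) • (unitSquare hu (x + y) - unitSquare hu (x - y)) := by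
    rw [unitMul]
    linear_combination (norm := module) (1 / 4 : ℝ) • h3
  rw [h4]
  exact smul_nonneg (by norm_num) h2

theorem unitMul_unit (y : principalIdeal hu) :
    unitMul hu ⟨u, unit_mem_principalIdeal hu⟩ y = y := by
  have h1 := (isUnitSquare_unitSquare hu y).unit_add
    (isUnitSquare_unitSquare hu (⟨u, unit_mem_principalIdeal hu⟩ + y))
  have h0 : unitSquare hu 0 = 0 := by
    have h := unitSquare_parallelogram hu 0 0
    rw [zero_add, sub_zero] at h
    linear_combination (norm := module) (-1 / 2 : ℝ) • h
  have h2 := (isUnitSquare_unitSquare hu 0).unit_add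
    (isUnitSquare_unitSquare hu (⟨u, unit_mem_principalIdeal hu⟩ + 0))
  rw [add_zero, ZeroMemClass.coe_zero, h0] at h2
  rw [unitMul, h1, h2]
  module

/-- For `0 ≤ x ≤ u`, multiplication by `x` is bounded by the identity. -/
theorem abs_unitMul_le {x : principalIdeal hu} (hx : 0 ≤ (x : F)) (hxu : (x : F) ≤ u)
    (y : principalIdeal hu) : |unitMul hu x y| ≤ |(y : F)| := by
  have hpos : ∀ z : principalIdeal hu, 0 ≤ (z : F) → unitMul hu x z ≤ z := by
    intro z hz
    have h1 : 0 ≤ unitMul hu (⟨u, unit_mem_principalIdeal hu⟩ - x) z :=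
      unitMul_nonneg hu (by push_cast; exact sub_nonneg.2 hxu) hz
    have h2 := unitMul_add hu z (⟨u, unit_mem_principalIdeal hu⟩ - x) x
    rw [sub_add_cancel, unitMul_comm hu z, unitMul_comm hu z, unitMul_comm hu z,
      unitMul_unit] at h2
    rw [h2]
    exact le_add_of_nonneg_left h1
  have hmem : ∀ w : F, |w| ≤ |(y : F)| → w ∈ principalIdeal hu := fun w hw =>
    mem_principalIdeal_of_abs_le hu y.2 hw
  let p : principalIdeal hu := ⟨(y : F)⁺, hmem _ (by
    rw [abs_of_nonneg (posPart_nonneg _), ← posPart_add_negPart (y : F)]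
    exact le_add_of_nonneg_right (negPart_nonneg _))⟩
  let n : principalIdeal hu := ⟨(y : F)⁻, hmem _ (by
    rw [abs_of_nonneg (negPart_nonneg _), ← posPart_add_negPart (y : F)]
    exact le_add_of_nonneg_left (posPart_nonneg _))⟩
  have hp : (0 : F) ≤ p := posPart_nonneg _
  have hn : (0 : F) ≤ n := negPart_nonneg _
  have h3 : unitMul hu x p = unitMul hu x y + unitMul hu x n := by
    rw [← unitMul_add]
    congr 1
    exact Subtype.ext (sub_eq_iff_eq_add.1 (posPart_sub_negPart (y : F)))
  have h4 : |(y : F)| = p + n := (posPart_add_negPart (y : F)).symm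
  have h5 := unitMul_nonneg hu hx hp
  have h6 := unitMul_nonneg hu hx hn
  rw [eq_sub_of_add_eq h3.symm, h4]
  refine abs_le'.2 ⟨?_, ?_⟩
  · exact (sub_le_self _ h6).trans ((hpos p hp).trans (le_add_of_nonneg_right hn))
  · rw [neg_sub]
    exact (sub_le_self _ h5).trans ((hpos n hn).trans (le_add_of_nonneg_left hp))

theorem exists_linear_unitMul {x : principalIdeal hu} (hx : 0 ≤ (x : F)) (hxu : (x : F) ≤ u) :
    ∃ M : principalIdeal hu →L[ℝ] F, ∀ y, M y = unitMul hu x y := by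
  let M : principalIdeal hu →+ F := AddMonoidHom.mk' (unitMul hu x) (unitMul_add hu x)
  have hM : ∀ y, ‖M y‖ ≤ 1 * ‖y‖ := fun y => by
    rw [one_mul]
    exact norm_le_norm_of_abs_le_abs (abs_unitMul_le hu hx hxu y)
  exact ⟨M.toRealLinearMap (AddMonoidHomClass.continuous_of_bound M 1 hM), fun y => rfl⟩

/-- When `u` is a quasi-interior point, every `x` with `0 ≤ x ≤ u` is the value at `u` of an
operator in the center: the extension to `F` of the multiplication by `x`. -/
theorem exists_mem_idealCenter_apply_eq (hq : IsQuasiInteriorPoint u) {x : F} (hx : 0 ≤ x)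
    (hxu : x ≤ u) : ∃ S ∈ idealCenter F, S u = x := by
  have hu := hq.1
  let x' : principalIdeal hu := ⟨x, 1, by rwa [one_smul, abs_of_nonneg hx]⟩
  obtain ⟨M, hM⟩ := exists_linear_unitMul hu (x := x') hx hxu
  have hdense : DenseRange (principalIdeal hu).subtypeL := by
    have h : Set.range (principalIdeal hu).subtypeL = {x : F | ∃ r : ℝ, |x| ≤ r • u} :=
      Subtype.range_coe
    rw [DenseRange, h]
    exact hq.2
  have hind : IsUniformInducing (principalIdeal hu).subtypeL := isUniformEmbedding_subtype_val.1
  have hS : ∀ y : principalIdeal hu, M.extend (principalIdeal hu).subtypeL y = unitMul hu x' y :=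
    fun y => (M.extend_eq hdense hind y).trans (hM y)
  refine ⟨M.extend (principalIdeal hu).subtypeL, ⟨1, one_pos, fun y hy => ?_⟩, ?_⟩
  · rw [one_smul]
    refine (hdense.induction_on (p := fun y => |M.extend (principalIdeal hu).subtypeL y| ≤ |y|)
      y ?_ fun z => ?_).trans_eq (abs_of_nonneg hy)
    · have habs : Continuous fun z : F => |z| := by
        simp only [abs]; fun_prop
      exact isClosed_le (habs.comp (ContinuousLinearMap.continuous _)) habs
    · exact (congrArg _ (hS z)).trans_le (abs_unitMul_le hu hx hxu z)
  · refine (hS ⟨u, unit_mem_principalIdeal hu⟩).trans ?_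
    rw [unitMul_comm, unitMul_unit]

end PrincipalIdeal

/-! ### The embedding of `C(K)` as an ideal of `F` -/

section Embedding

open Filter Topology

variable {K F : Type*} [TopologicalSpace K] [CompactSpace K]
  [NormedAddCommGroup F] [NormedSpace ℝ F] [Lattice F]
  [IsOrderedAddMonoid F] [IsOrderedModule ℝ F]

namespace CenterIdentification

variable (φ : CenterIdentification K F)

/-- The operator on `F` that corresponds to `a ∈ C(K)`. -/
def op (a : C(K, ℝ)) : F →L[ℝ] F := (φ.toAlgEquiv a : F →L[ℝ] F)

theorem op_mul (a b : C(K, ℝ)) (x : F) : φ.op (a * b) x = φ.op a (φ.op b x) := by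
  simp [op]

theorem op_one (x : F) : φ.op 1 x = x := by
  simp [op]

theorem op_sub (a b : C(K, ℝ)) (x : F) : φ.op (a - b) x = φ.op a x - φ.op b x := by
  simp [op]

theorem op_smul (c : ℝ) (a : C(K, ℝ)) (x : F) : φ.op (c • a) x = c • φ.op a x := by
  simp [op]

theorem op_mono {a b : C(K, ℝ)} (h : a ≤ b) {x : F} (hx : 0 ≤ x) : φ.op a x ≤ φ.op b x := by
  have h1 := (φ.nonneg_iff (b - a)).1 (sub_nonneg.2 h) x hx
  exact sub_nonneg.1 (h1.trans_eq (φ.op_sub b a x))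

theorem norm_op_apply_le (a : C(K, ℝ)) (x : F) : ‖φ.op a x‖ ≤ ‖a‖ * ‖x‖ :=
  ((φ.op a).le_opNorm x).trans_eq (by rw [op, φ.norm_map])

theorem op_embed (u : F) (a b : C(K, ℝ)) : φ.op a (φ.embed u b) = φ.embed u (a * b) :=
  (φ.op_mul a b u).symm

theorem abs_op_le {a b : C(K, ℝ)} (h : |a| ≤ b) (x : F) : |φ.op a x| ≤ φ.op b |x| := by
  have hpos : ∀ y : F, 0 ≤ y → |φ.op a y| ≤ φ.op b y := fun y hy => by
    refine abs_le'.2 ⟨φ.op_mono ((le_abs_self a).trans h) hy, ?_⟩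
    have h1 := φ.op_mono ((neg_le_abs a).trans h) hy
    rwa [show φ.op (-a) y = -φ.op a y by simp [op]] at h1
  have h1 := add_le_add (hpos _ (posPart_nonneg x)) (hpos _ (negPart_nonneg x))
  rw [← map_add, posPart_add_negPart] at h1
  refine le_trans ?_ h1
  conv_lhs => rw [← posPart_sub_negPart x, map_sub, sub_eq_add_neg]
  exact (abs_add_le _ _).trans (by rw [abs_neg])

variable [HasSolidNorm F]

/-- The operators in the center that correspond to `a` and `|a|` satisfy `|a x| = |a| x`. For the
nontrivial inequality, `a` is multiplied by the approximate signs `a / (|a| + ε)`. -/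
theorem abs_op_eq (a : C(K, ℝ)) {x : F} (hx : 0 ≤ x) : |φ.op a x| = φ.op |a| x := by
  refine le_antisymm ((φ.abs_op_le le_rfl x).trans_eq (by rw [abs_of_nonneg hx])) ?_
  have key : ∀ ε : ℝ, 0 < ε → φ.op |a| x - ε • x ≤ |φ.op a x| := by
    intro ε hε
    have hpos : ∀ t, 0 < |a t| + ε := fun t => by positivity
    let s : C(K, ℝ) := ⟨fun t => a t / (|a t| + ε),
      a.continuous.div (by fun_prop) fun t => (hpos t).ne'⟩
    have hs : |s| ≤ 1 := fun t => by
      change |a t / (|a t| + ε)| ≤ 1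
      rw [abs_div, abs_of_pos (hpos t), div_le_one (hpos t)]
      linarith
    have hsa : |a| - ε • 1 ≤ s * a := fun t => by
      change |a t| - ε * 1 ≤ a t / (|a t| + ε) * a t
      rw [div_mul_eq_mul_div, le_div_iff₀ (hpos t), ← abs_mul_abs_self (a t)]
      nlinarith [sq_nonneg ε]
    calc φ.op |a| x - ε • x = φ.op (|a| - ε • 1) x := by rw [op_sub, op_smul, op_one]
      _ ≤ φ.op (s * a) x := φ.op_mono hsa hx
      _ ≤ |φ.op (s * a) x| := le_abs_self _
      _ = |φ.op s (φ.op a x)| := by rw [op_mul]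
      _ ≤ φ.op 1 |φ.op a x| := φ.abs_op_le hs _
      _ = |φ.op a x| := φ.op_one _
  have h1 : Tendsto (fun ε : ℝ => φ.op |a| x - ε • x) (𝓝[>] 0) (𝓝 (φ.op |a| x)) := by
    have : Continuous fun ε : ℝ => φ.op |a| x - ε • x := by fun_prop
    simpa using (this.tendsto 0).mono_left nhdsWithin_le_nhds
  exact le_of_tendsto h1 (eventually_nhdsWithin_of_forall key)

variable {u : F}

theorem abs_embed (hu : 0 ≤ u) (a : C(K, ℝ)) : |φ.embed u a| = φ.embed u |a| :=
  φ.abs_op_eq a hu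

theorem norm_embed_abs (hu : 0 ≤ u) (a : C(K, ℝ)) : ‖φ.embed u |a|‖ = ‖φ.embed u a‖ := by
  rw [← φ.abs_embed hu, norm_abs_eq_norm]

theorem embed_one : φ.embed u 1 = u := φ.op_one u

theorem embed_inf (hu : 0 ≤ u) (a b : C(K, ℝ)) :
    φ.embed u (a ⊓ b) = φ.embed u a ⊓ φ.embed u b := by
  have h : a ⊓ b = (2⁻¹ : ℝ) • (a + b - |b - a|) := inf_eq_half_smul_add_sub_abs_sub' ℝ a b
  rw [h, inf_eq_half_smul_add_sub_abs_sub' ℝ, map_smul, map_sub, ← φ.abs_embed hu, map_add, map_sub]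

theorem embed_sup (hu : 0 ≤ u) (a b : C(K, ℝ)) :
    φ.embed u (a ⊔ b) = φ.embed u a ⊔ φ.embed u b := by
  have h : a ⊔ b = (2⁻¹ : ℝ) • (a + b + |b - a|) := sup_eq_half_smul_add_add_abs_sub' ℝ a b
  rw [h, sup_eq_half_smul_add_add_abs_sub' ℝ, map_smul, map_add, ← φ.abs_embed hu, map_add, map_sub]

variable [CompleteSpace F]

/-- The image of `C(K)` in `F` is the whole ideal generated by `u`. -/
theorem exists_embed_eq (hu : IsQuasiInteriorPoint u) {x : F} {r : ℝ} (hx : |x| ≤ r • u) :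
    ∃ a, φ.embed u a = x := by
  have h1 : ∀ y : F, 0 ≤ y → y ≤ u → y ∈ LinearMap.range (φ.embed u) := fun y hy hyu => by
    obtain ⟨S, hS, rfl⟩ := exists_mem_idealCenter_apply_eq hu hy hyu
    exact ⟨φ.toAlgEquiv.symm ⟨S, hS⟩, by simp [embed]⟩
  obtain ⟨s, hs, hxs⟩ := exists_pos_abs_le hu.1 (show x ∈ principalIdeal hu.1 from ⟨r, hx⟩)
  have h2 : ∀ y : F, 0 ≤ y → y ≤ |x| → y ∈ LinearMap.range (φ.embed u) := fun y hy hyx => by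
    have h3 := Submodule.smul_mem _ s (h1 (s⁻¹ • y) (smul_nonneg (inv_nonneg.2 hs.le) hy) ?_)
    · rwa [smul_smul, mul_inv_cancel₀ hs.ne', one_smul] at h3
    · have h4 := smul_le_smul_of_nonneg_left (hyx.trans hxs) (inv_nonneg.2 hs.le)
      rwa [smul_smul, inv_mul_cancel₀ hs.ne', one_smul] at h4
  have h5 := h2 _ (posPart_nonneg x) (by
    rw [← posPart_add_negPart x]; exact le_add_of_nonneg_right (negPart_nonneg x))
  have h6 := h2 _ (negPart_nonneg x) (by
    rw [← posPart_add_negPart x]; exact le_add_of_nonneg_left (posPart_nonneg x))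
  have h7 := Submodule.sub_mem _ h5 h6
  rwa [posPart_sub_negPart] at h7

theorem denseRange_embed (hu : IsQuasiInteriorPoint u) : DenseRange (φ.embed u) :=
  Dense.mono (s₁ := {x : F | ∃ r : ℝ, |x| ≤ r • u})
    (fun _ ⟨_, hr⟩ => φ.exists_embed_eq hu hr) hu.2

theorem embed_injective (hu : IsQuasiInteriorPoint u) : Function.Injective (φ.embed u) := by
  rw [injective_iff_map_eq_zero]
  intro a ha
  have h : φ.op a = 0 := by
    ext x
    refine (φ.denseRange_embed hu).induction_on (p := fun x => φ.op a x = 0) x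
      (isClosed_eq (φ.op a).continuous continuous_const) fun b => ?_
    rw [op_embed, mul_comm, ← op_embed, ha, map_zero]
  rw [← norm_eq_zero, ← φ.norm_map]
  exact norm_eq_zero.2 h

end CenterIdentification

/-- A quasi-interior point is a weak order unit. -/
theorem IsQuasiInteriorPoint.eq_zero_of_inf_eq_zero [HasSolidNorm F] {u : F}
    (hu : IsQuasiInteriorPoint u) {h : F} (hh : 0 ≤ h) (hinf : h ⊓ u = 0) : h = 0 := by
  have hmem : h ∈ {y : F | h ⊓ |y| = 0} := by
    have habs : Continuous fun z : F => |z| := by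
      simp only [abs]; fun_prop
    have hclosed : IsClosed {y : F | h ⊓ |y| = 0} :=
      isClosed_eq (continuous_const.inf habs) continuous_const
    refine (hclosed.closure_subset_iff.2 ?_) (hu.2 h)
    intro y hy
    obtain ⟨r, hr, hyr⟩ := exists_pos_abs_le hu.1 (show y ∈ principalIdeal hu.1 from hy)
    refine le_antisymm ?_ (le_inf hh (abs_nonneg y))
    have hr1 : 0 ≤ (r + 1)⁻¹ := by positivity
    have hr2 : (r + 1) * (r + 1)⁻¹ = 1 := mul_inv_cancel₀ (by positivity)
    have h2 : (r + 1)⁻¹ • (h ⊓ |y|) ≤ h ⊓ u := by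
      refine le_inf ?_ ?_
      · refine (smul_le_smul_of_nonneg_left inf_le_left hr1).trans ?_
        exact (smul_le_smul_of_nonneg_right (inv_le_one_of_one_le₀ (by linarith)) hh).trans_eq
          (one_smul ℝ h)
      · refine (smul_le_smul_of_nonneg_left (inf_le_right.trans hyr) hr1).trans ?_
        rw [smul_smul]
        refine (smul_le_smul_of_nonneg_right ?_ hu.1).trans_eq (one_smul ℝ u)
        nlinarith
    rw [hinf] at h2
    have h3 := smul_le_smul_of_nonneg_left h2 (show 0 ≤ r + 1 by positivity)
    rwa [smul_smul, hr2, one_smul, smul_zero] at h3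
  have h1 : h ⊓ |h| = 0 := hmem
  rwa [abs_of_nonneg hh, inf_idem] at h1

variable [HasSolidNorm F] [CompleteSpace F]

/-- If `g ∈ F` satisfies `‖b g‖ ≤ C ‖b u‖` for all `b ∈ C(K)`, then `|g| ≤ (C + 1) u`. The
inequality is tested on functions `b` that live where `g` exceeds `(C + 1) u`. -/
theorem CenterIdentification.abs_le_of_norm_op_le (φ : CenterIdentification K F) {u : F}
    (hu : IsQuasiInteriorPoint u) {g : F} {C : ℝ} (hC : 0 ≤ C)
    (hg : ∀ b : C(K, ℝ), ‖φ.op b g‖ ≤ C * ‖φ.embed u b‖) : |g| ≤ (C + 1) • u := by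
  have hu0 := hu.1
  let ψ : F → F := fun y => ((|y| - (C + 1) • u) ⊔ 0) ⊓ u
  have hψ : Continuous ψ := by
    simp only [ψ, abs]; fun_prop
  let β : C(K, ℝ) → C(K, ℝ) := fun a => ((|a| - (C + 1) • 1) ⊔ 0) ⊓ 1
  have hβ : ∀ a, φ.embed u (β a) = ψ (φ.embed u a) := fun a => by
    simp only [β, ψ]
    rw [φ.embed_inf hu0, φ.embed_sup hu0, map_sub, map_smul, map_zero, φ.embed_one,
      φ.abs_embed hu0]
  have hest : ∀ a, ‖ψ (φ.embed u a)‖ ≤ ‖φ.embed u a - g‖ := by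
    intro a
    have hb0 : 0 ≤ β a := le_inf le_sup_right zero_le_one
    have hb1 : ‖β a‖ ≤ 1 := by
      rw [ContinuousMap.norm_le _ zero_le_one]
      intro t
      have ht0 : 0 ≤ β a t := hb0 t
      rw [Real.norm_of_nonneg ht0]
      exact (inf_le_right : β a ≤ 1) t
    have hmul : (C + 1) • β a ≤ |β a * a| := by
      intro t
      have ht0 : 0 ≤ β a t := hb0 t
      change (C + 1) * β a t ≤ |β a t * a t|
      rw [abs_mul, abs_of_nonneg ht0, mul_comm]
      rcases le_total (|a t| - (C + 1)) 0 with h | h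
      · have h0 : β a t = 0 := by
          change ((|a t| - (C + 1) * 1) ⊔ 0) ⊓ 1 = 0
          rw [mul_one, sup_eq_right.2 h]; simp
        simp [h0]
      · exact mul_le_mul_of_nonneg_left (by linarith) ht0
    have h1 : (C + 1) * ‖φ.embed u (β a)‖ ≤ ‖φ.embed u (β a * a)‖ := by
      have h2 := φ.norm_embed_le hu0 (smul_nonneg (by positivity) hb0) hmul
      rwa [map_smul, norm_smul, Real.norm_of_nonneg (by positivity), φ.norm_embed_abs hu0] at h2
    have h3 : φ.embed u (β a * a) = φ.op (β a) g + φ.op (β a) (φ.embed u a - g) := by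
      rw [← map_add, add_sub_cancel, φ.op_embed]
    have h4 : ‖φ.op (β a) (φ.embed u a - g)‖ ≤ ‖φ.embed u a - g‖ :=
      (φ.norm_op_apply_le _ _).trans (mul_le_of_le_one_left (norm_nonneg _) hb1)
    rw [← hβ]
    rw [h3] at h1
    linarith [norm_add_le (φ.op (β a) g) (φ.op (β a) (φ.embed u a - g)), hg (β a)]
  have hall : ∀ y, ‖ψ y‖ ≤ ‖y - g‖ := fun y =>
    (φ.denseRange_embed hu).induction_on (p := fun y => ‖ψ y‖ ≤ ‖y - g‖) y
      (isClosed_le hψ.norm (by fun_prop)) hest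
  have hzero : ψ g = 0 := norm_le_zero_iff.1 (by simpa using hall g)
  have h5 := hu.eq_zero_of_inf_eq_zero le_sup_right hzero
  rw [sup_eq_right, sub_nonpos] at h5
  exact h5

end Embedding

/-! ### Approximation by sums of products `a x` -/

/-- Functions with values in a finite-dimensional subspace are dense in `C(K, X)`. -/
theorem exists_norm_sub_sum_smul_const_le {K X : Type*} [TopologicalSpace K] [CompactSpace K]
    [T2Space K] [NormedAddCommGroup X] [NormedSpace ℝ X] (f : C(K, X)) {ε : ℝ} (hε : 0 < ε) :
    ∃ (n : ℕ) (ρ : Fin n → C(K, ℝ)) (x : Fin n → X),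
      ‖f - ∑ i, ρ i • ContinuousMap.const K (x i)‖ ≤ ε := by
  have hopen : ∀ t, IsOpen (f ⁻¹' Metric.ball (f t) ε) := fun t =>
    Metric.isOpen_ball.preimage f.continuous
  obtain ⟨S, hS⟩ := CompactSpace.elim_nhds_subcover (fun t => f ⁻¹' Metric.ball (f t) ε)
    fun t => (hopen t).mem_nhds (Metric.mem_ball_self hε)
  let e := S.equivFin.symm
  obtain ⟨ρ, hsupp, hsum, h01, -⟩ := exists_continuous_sum_one_of_isOpen_isCompact
    (t := Set.univ) (s := fun i => f ⁻¹' Metric.ball (f (e i)) ε) (fun i => hopen _) isCompact_univ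
    (by
      intro t _
      have ht : t ∈ ⋃ y ∈ S, f ⁻¹' Metric.ball (f y) ε := hS ▸ trivial
      simp only [Set.mem_iUnion] at ht
      obtain ⟨y, hy, hty⟩ := ht
      exact Set.mem_iUnion.2 ⟨e.symm ⟨y, hy⟩, by simpa using hty⟩)
  refine ⟨S.card, ρ, fun i => f (e i), (ContinuousMap.norm_le _ hε.le).2 fun t => ?_⟩
  have h1 : ∑ i, ρ i t = 1 := by simpa using hsum (Set.mem_univ t)
  have h2 : (f - ∑ i, ρ i • ContinuousMap.const K (f (e i))) t =
      ∑ i, ρ i t • (f t - f (e i)) := by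
    simp only [smul_sub, Finset.sum_sub_distrib, ← Finset.sum_smul, h1, one_smul]
    simp
  rw [h2]
  calc ‖∑ i, ρ i t • (f t - f (e i))‖ ≤ ∑ i, ρ i t * ε := by
        refine norm_sum_le_of_le _ fun i _ => ?_
        rw [norm_smul, Real.norm_of_nonneg (h01 i t).1]
        by_cases h : ρ i t = 0
        · simp [h]
        · refine mul_le_mul_of_nonneg_left ?_ (h01 i t).1
          have h3 := hsupp i (subset_tsupport _ h)
          rw [Set.mem_preimage, mem_ball_iff_norm] at h3
          exact h3.le
    _ = ε := by rw [← Finset.sum_mul, h1, one_mul]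

/-! ### The space `F_π(X)` -/

section FpiSpace

variable {K F X : Type*} [TopologicalSpace K] [CompactSpace K]
  [NormedAddCommGroup F] [NormedSpace ℝ F] [Lattice F]
  [IsOrderedAddMonoid F] [IsOrderedModule ℝ F] [HasSolidNorm F]
  [NormedAddCommGroup X] [NormedSpace ℝ X]
  (φ : CenterIdentification K F) {u : F} (hu : IsQuasiInteriorPoint u)

/-- The canonical map `C(K, X) → F_π(X)`. -/
noncomputable def Fpi.ofMap : C(K, X) →ₗ[ℝ] Fpi φ hu X where
  toFun f := ((PreFpi.of φ hu X f : PreFpi φ hu X) : Fpi φ hu X)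
  map_add' f g := UniformSpace.Completion.coe_add (PreFpi.of φ hu X f) (PreFpi.of φ hu X g)
  map_smul' c f := UniformSpace.Completion.coe_smul c (PreFpi.of φ hu X f)

theorem Fpi.smul_ofMap (a : C(K, ℝ)) (f : C(K, X)) :
    a • Fpi.ofMap φ hu f = Fpi.ofMap φ hu (a • f) :=
  (UniformSpace.Completion.coe_smul a (PreFpi.of φ hu X f)).symm

theorem Fpi.ofMap_const (x : X) : Fpi.ofMap φ hu (ContinuousMap.const K x) = Fpi.const φ hu x :=
  rfl

theorem Fpi.norm_ofMap (f : C(K, X)) : ‖Fpi.ofMap φ hu f‖ = ‖φ.embed u (normFunction f)‖ :=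
  UniformSpace.Completion.norm_coe (PreFpi.of φ hu X f)

theorem Fpi.denseRange_ofMap : DenseRange (Fpi.ofMap φ hu (X := X)) :=
  UniformSpace.Completion.denseRange_coe (α := PreFpi φ hu X)

theorem Fpi.continuous_ofMap : Continuous (Fpi.ofMap φ hu (X := X)) := by
  refine AddMonoidHomClass.continuous_of_bound (Fpi.ofMap φ hu (X := X)) ‖u‖ fun f => ?_
  have h : normFunction f ≤ ‖f‖ • (1 : C(K, ℝ)) := fun t => by
    change ‖f t‖ ≤ ‖f‖ * 1
    rw [mul_one]
    exact f.norm_coe_le_norm t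
  rw [Fpi.norm_ofMap]
  refine (φ.norm_embed_le hu.1 (fun t => norm_nonneg _) h).trans_eq ?_
  rw [map_smul, norm_smul, norm_norm, φ.embed_one, mul_comm]

theorem Fpi.norm_smul_const (a : C(K, ℝ)) (x : X) :
    ‖a • Fpi.const φ hu x‖ = ‖x‖ * ‖φ.embed u a‖ := by
  rw [← Fpi.ofMap_const, Fpi.smul_ofMap, Fpi.norm_ofMap]
  have h : normFunction (a • ContinuousMap.const K x) = ‖x‖ • |a| := by
    ext t
    change ‖a t • x‖ = ‖x‖ * |a t|
    rw [norm_smul, mul_comm, Real.norm_eq_abs]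
  rw [h, map_smul, norm_smul, norm_norm, φ.norm_embed_abs hu.1]

theorem Fpi.const_mem_cyclicSubspace (x : X) :
    Fpi.const φ hu x ∈ cyclicSubspace K (Fpi.const φ hu x) :=
  subset_closure ⟨1, one_smul _ _⟩

variable [CompleteSpace F]

theorem Fpi.ofMap_injective : Function.Injective (Fpi.ofMap φ hu (X := X)) := by
  rw [injective_iff_map_eq_zero]
  intro f hf
  rw [← norm_eq_zero, Fpi.norm_ofMap, norm_eq_zero] at hf
  have h := φ.embed_injective hu (hf.trans (map_zero _).symm)
  ext t
  exact norm_eq_zero.1 (DFunLike.congr_fun h t)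

/-- The map `F → F_π(X)` that extends `a ↦ a x` from `C(K)` to `F`. For `x ≠ 0` it identifies
`F`, up to the factor `‖x‖`, with the cyclic subspace of the constant function `x`. -/
noncomputable def Fpi.orbit (x : X) : F →L[ℝ] Fpi φ hu X :=
  (Fpi.ofMap φ hu ∘ₗ
    { toFun := fun a : C(K, ℝ) => a • ContinuousMap.const K x
      map_add' := fun a b => add_smul a b _
      map_smul' := fun c a => by ext t; exact mul_smul c (a t) x }).extendOfNorm (φ.embed u)

theorem Fpi.orbit_embed (x : X) (a : C(K, ℝ)) :
    Fpi.orbit φ hu x (φ.embed u a) = a • Fpi.const φ hu x := by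
  have h : ∀ a : C(K, ℝ), Fpi.ofMap φ hu (a • ContinuousMap.const K x) = a • Fpi.const φ hu x :=
    fun a => (Fpi.smul_ofMap φ hu a _).symm
  refine (LinearMap.extendOfNorm_eq (φ.denseRange_embed hu) ⟨‖x‖, fun b => ?_⟩ a).trans (h a)
  exact ((congrArg _ (h b)).trans (Fpi.norm_smul_const φ hu b x)).le

theorem Fpi.norm_orbit (x : X) (y : F) : ‖Fpi.orbit φ hu x y‖ = ‖x‖ * ‖y‖ :=
  (φ.denseRange_embed hu).induction_on (p := fun y => ‖Fpi.orbit φ hu x y‖ = ‖x‖ * ‖y‖) y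
    (isClosed_eq (Fpi.orbit φ hu x).continuous.norm (by fun_prop)) fun a => by
      rw [Fpi.orbit_embed, Fpi.norm_smul_const]

theorem Fpi.orbit_op (x : X) (a : C(K, ℝ)) (y : F) :
    Fpi.orbit φ hu x (φ.op a y) = a • Fpi.orbit φ hu x y :=
  (φ.denseRange_embed hu).induction_on
    (p := fun y => Fpi.orbit φ hu x (φ.op a y) = a • Fpi.orbit φ hu x y) y
    (isClosed_eq ((Fpi.orbit φ hu x).continuous.comp (φ.op a).continuous)
      ((Fpi.orbit φ hu x).continuous.const_smul a)) fun b => by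
      rw [φ.op_embed, Fpi.orbit_embed, Fpi.orbit_embed, mul_smul]

theorem Fpi.cyclicSubspace_const_subset_range_orbit {x : X} (hx : x ≠ 0) :
    cyclicSubspace K (Fpi.const φ hu x) ⊆ Set.range (Fpi.orbit φ hu x) := by
  have hx' : 0 < ‖x‖ := norm_pos_iff.2 hx
  have hanti : AntilipschitzWith (‖x‖₊⁻¹) (Fpi.orbit φ hu x) :=
    AddMonoidHomClass.antilipschitz_of_bound _ fun y => by
      rw [Fpi.norm_orbit, NNReal.coe_inv, coe_nnnorm, inv_mul_cancel_left₀ hx'.ne']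
  refine closure_minimal ?_ (hanti.isClosed_range (Fpi.orbit φ hu x).uniformContinuous)
  rintro _ ⟨a, rfl⟩
  exact ⟨φ.embed u a, Fpi.orbit_embed φ hu x a⟩

/-- An operator that leaves the cyclic subspace of a constant function `x` invariant and commutes
with `C(K)` there multiplies `x` by an element of `C(K)`. -/
theorem Fpi.exists_apply_const_eq_smul (T : Fpi φ hu X →L[ℝ] Fpi φ hu X) {x : X}
    (hmaps : T (Fpi.const φ hu x) ∈ cyclicSubspace K (Fpi.const φ hu x))
    (hcomm : ∀ a : C(K, ℝ), T (a • Fpi.const φ hu x) = a • T (Fpi.const φ hu x)) :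
    ∃ b : C(K, ℝ), T (Fpi.const φ hu x) = b • Fpi.const φ hu x := by
  rcases eq_or_ne x 0 with rfl | hx
  · have h0 : Fpi.const φ hu (0 : X) = 0 := map_zero (Fpi.ofMap φ hu)
    exact ⟨0, by rw [h0, map_zero, smul_zero]⟩
  have hx' : 0 < ‖x‖ := norm_pos_iff.2 hx
  obtain ⟨g, hg⟩ := Fpi.cyclicSubspace_const_subset_range_orbit φ hu hx hmaps
  have hbound : ∀ b : C(K, ℝ), ‖φ.op b g‖ ≤ ‖T‖ * ‖φ.embed u b‖ := fun b => by
    have h1 := T.le_opNorm (b • Fpi.const φ hu x)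
    rw [hcomm, ← hg, ← Fpi.orbit_op, Fpi.norm_orbit, Fpi.norm_smul_const, mul_left_comm] at h1
    exact le_of_mul_le_mul_left h1 hx'
  obtain ⟨b, rfl⟩ := φ.exists_embed_eq hu (φ.abs_le_of_norm_op_le hu (norm_nonneg T) hbound)
  exact ⟨b, by rw [← hg, Fpi.orbit_embed]⟩

/-- If `T` multiplies every constant function by some element of `C(K)`, the multiplier can be
chosen independently of the constant: at each point of `K`, every vector is an eigenvector of the
linear map `x ↦ (T x)(t)`. -/
theorem Fpi.exists_forall_apply_const_eq_smul (T : Fpi φ hu X →L[ℝ] Fpi φ hu X)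
    (h : ∀ x : X, ∃ b : C(K, ℝ), T (Fpi.const φ hu x) = b • Fpi.const φ hu x) :
    ∃ b : C(K, ℝ), ∀ x : X, T (Fpi.const φ hu x) = b • Fpi.const φ hu x := by
  choose b hb using h
  rcases subsingleton_or_nontrivial X with hX | hX
  · exact ⟨b 0, fun x => Subsingleton.elim 0 x ▸ hb 0⟩
  obtain ⟨x₀, hx₀⟩ := exists_ne (0 : X)
  have hof : ∀ x, T (Fpi.const φ hu x) = Fpi.ofMap φ hu (b x • ContinuousMap.const K x) :=
    fun x => (hb x).trans (Fpi.smul_ofMap φ hu (b x) (ContinuousMap.const K x))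
  have hadd : ∀ x y, b (x + y) • ContinuousMap.const K (x + y) =
      b x • ContinuousMap.const K x + b y • ContinuousMap.const K y := fun x y => by
    refine Fpi.ofMap_injective φ hu ?_
    rw [map_add, ← hof, ← hof, ← hof, ← map_add]
    exact congrArg T (map_add (Fpi.ofMap φ hu) (ContinuousMap.const K x) (ContinuousMap.const K y))
  have hsmul : ∀ (c : ℝ) x, b (c • x) • ContinuousMap.const K (c • x) =
      c • (b x • ContinuousMap.const K x) := fun c x => by
    refine Fpi.ofMap_injective φ hu ?_
    rw [(Fpi.ofMap φ hu).map_smul, ← hof, ← hof, ← T.map_smul]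
    exact congrArg T (map_smul (Fpi.ofMap φ hu) c (ContinuousMap.const K x))
  refine ⟨b x₀, fun x => ?_⟩
  rw [hof, ← Fpi.ofMap_const, Fpi.smul_ofMap]
  congr 1
  ext t
  let L : X →ₗ[ℝ] X :=
    { toFun := fun x => b x t • x
      map_add' := fun x y => DFunLike.congr_fun (hadd x y) t
      map_smul' := fun c x => DFunLike.congr_fun (hsmul c x) t }
  have hL : ∀ v, ¬ LinearIndependent ℝ ![v, L v] := fun v hv => by
    have h1 := LinearIndependent.pair_iff.1 hv (b v t) (-1)
      (by rw [neg_one_smul]; exact add_neg_cancel (b v t • v))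
    exact neg_ne_zero.2 one_ne_zero h1.2
  obtain ⟨c, hc⟩ := LinearMap.exists_eq_smul_id_of_forall_notLinearIndependent hL
  have hc' : ∀ v, b v t • v = c • v := fun v => LinearMap.congr_fun hc v
  have hc₀ : b x₀ t = c := smul_left_injective ℝ hx₀ (hc' x₀)
  change b x t • x = b x₀ t • x
  rw [hc', hc₀]

end FpiSpace

theorem theorem3 {K F X : Type*} [TopologicalSpace K] [CompactSpace K] [T2Space K]
    [NormedAddCommGroup F] [NormedSpace ℝ F] [CompleteSpace F] [Lattice F]
    [IsOrderedAddMonoid F] [IsOrderedModule ℝ F] [HasSolidNorm F]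
    [NormedAddCommGroup X] [NormedSpace ℝ X] [CompleteSpace X]
    (φ : CenterIdentification K F) {u : F} (hu : IsQuasiInteriorPoint u)
    (T : Fpi φ hu X →L[ℝ] Fpi φ hu X) :
    IsMultiplicationOperator K T ↔
      (∀ x : X, ∀ f ∈ cyclicSubspace K (Fpi.const φ hu x),
        T f ∈ cyclicSubspace K (Fpi.const φ hu x)) ∧
      (∀ x : X, ∀ f ∈ cyclicSubspace K (Fpi.const φ hu x),
        ∀ a : C(K, ℝ), T (a • f) = a • T f) := by
  constructor
  · rintro ⟨b, hb⟩
    refine ⟨fun x f hf => ?_, fun x f _ a => ?_⟩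
    · rw [hb]
      refine map_mem_closure (continuous_const_smul b) hf ?_
      rintro _ ⟨a, rfl⟩
      exact ⟨b * a, mul_smul b a _⟩
    · rw [hb, hb, smul_comm]
  · rintro ⟨hmaps, hcomm⟩
    have hcomm' : ∀ (x : X) (a : C(K, ℝ)),
        T (a • Fpi.const φ hu x) = a • T (Fpi.const φ hu x) := fun x a =>
      hcomm x _ (Fpi.const_mem_cyclicSubspace φ hu x) a
    obtain ⟨b, hb⟩ := Fpi.exists_forall_apply_const_eq_smul φ hu T fun x =>
      Fpi.exists_apply_const_eq_smul φ hu T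
        (hmaps x _ (Fpi.const_mem_cyclicSubspace φ hu x)) (hcomm' x)
    have hsmul : Continuous fun m : Fpi φ hu X => b • m := continuous_const_smul b
    have hι : Continuous (Fpi.ofMap φ hu (X := X)) := Fpi.continuous_ofMap φ hu
    refine ⟨b, fun m => (Fpi.denseRange_ofMap φ hu).induction_on (p := fun m => T m = b • m) m
      (isClosed_eq T.continuous hsmul) fun f => ?_⟩
    have hclosed : IsClosed {f : C(K, X) | T (Fpi.ofMap φ hu f) = b • Fpi.ofMap φ hu f} :=
      isClosed_eq (T.continuous.comp hι) (hsmul.comp hι)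
    refine hclosed.closure_subset (Metric.mem_closure_iff.2 fun ε hε => ?_)
    obtain ⟨n, ρ, x, hf⟩ := exists_norm_sub_sum_smul_const_le f (half_pos hε)
    refine ⟨_, ?_, (dist_eq_norm f _).trans_lt (hf.trans_lt (half_lt_self hε))⟩
    change T _ = b • _
    simp only [map_sum, Finset.smul_sum]
    refine Finset.sum_congr rfl fun i _ => ?_
    rw [← Fpi.smul_ofMap, Fpi.ofMap_const, hcomm', hb, smul_comm]
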